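/- Let $n\ge 1$ and let $[n]$ be a set of $n$ nodes. For directed graphs $A,B$ on $[n]$, the product graph $A\circ B$ is the directed graph on $[n]$ in which $(x,y)$ is an edge if and only if there is a node $z$ such that $(x,z)$ is an edge of $A$ and $(z,y)$ is an edge of $B$. Let $\mathcal{T}_n$ be the set of directed graphs on $[n]$ obtained from a rooted tree with node set $[n]$, all edges directed away from the root, by adding a self-loop at every node. For a sequence $G_1,G_2,\dots$ of directed graphs on $[n]$, let the broadcast time $$t^*(G_1,G_2,\dots)=\min\{t\ge 1:\ \exists x\in[n]\ \forall y\in[n],\ (x,y)\text{ is an edge of }G_1\circ\cdots\circ G_t\},$$ where the minimum is $\infty$ if there is no such $t$. Then the maximum $$t^*(\mathcal{T}_n)=\max\{t^*(G_1,G_2,\dots):\ G_i\in\mathcal{T}_n\text{ for all }i\ge 1\}$$ exists, is finite, and satisfies $$\left\lceil\frac{3n-1}{2}\right\rceil-2\ \le\ t^*(\mathcal{T}_n)\ \le\ \left\lceil(1+\sqrt2)\,n-1\right\rceil .$$ In particular, the broadcast time in dynamic rooted trees is linear in $n$. -/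

import Mathlib

namespace DynamicBroadcast

/-- The product graph `A ∘ B`: `(x, y)` is an edge iff for some node `z`, `(x, z)` is an edge of `A`
and `(z, y)` is an edge of `B`. -/
def product {V : Type*} (A B : Digraph V) : Digraph V where
  Adj x y := ∃ z, A.Adj x z ∧ B.Adj z y

/-- The digraph whose only edges are the self-loops; it is the identity for `product`. -/
def loops (V : Type*) : Digraph V where
  Adj x y := x = y

/-- `T` with a self-loop added at every node. -/
def addLoops {V : Type*} (T : Digraph V) : Digraph V where
  Adj x y := x = y ∨ T.Adj x y

/-- For a sequence of networks, where `G i` is the network of round `i + 1`, the product graph of the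
first `t` rounds, that is `G 0 ∘ G 1 ∘ ⋯ ∘ G (t - 1)` (for `t = 0`, the empty product). -/
def productUpTo {V : Type*} (G : ℕ → Digraph V) : ℕ → Digraph V
  | 0 => loops V
  | t + 1 => product (productUpTo G t) (G t)

/-- Some node has an edge to every node of `A`. -/
def HasBroadcaster {V : Type*} (A : Digraph V) : Prop :=
  ∃ x, ∀ y, A.Adj x y

/-- The broadcast time of a sequence of networks: the least round `t ≥ 1` after which the product
graph has a node with an edge to every node (and `⊤` if there is no such round). -/
noncomputable def broadcastTime {V : Type*} (G : ℕ → Digraph V) : ℕ∞ :=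
  ⨅ t : {t : ℕ // 1 ≤ t ∧ HasBroadcaster (productUpTo G t)}, ((t : ℕ) : ℕ∞)

/-- `T` is a tree with root `r`, all edges being directed away from the root: no edge enters `r`,
exactly one edge enters every other node, and every node is reached from `r` by a directed path. -/
structure IsRootedTreeAt {V : Type*} (T : Digraph V) (r : V) : Prop where
  no_parent_root : ∀ x, ¬ T.Adj x r
  unique_parent : ∀ y, y ≠ r → ∃! x, T.Adj x y
  reachable : ∀ y, Relation.ReflTransGen T.Adj r y

/-- The rooted trees on the node set `Fin n`, each with a self-loop added at every node. -/
def rootedTrees (n : ℕ) : Set (Digraph (Fin n)) :=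
  {A | ∃ T : Digraph (Fin n), (∃ r, IsRootedTreeAt T r) ∧ A = addLoops T}

/-- `τ` is the broadcast time of the adversary that picks, in every round, an arbitrary network
from `𝒢`: the maximum (which is attained) of the broadcast times of all sequences from `𝒢`. -/
def IsAdversaryBroadcastTime {V : Type*} (𝒢 : Set (Digraph V)) (τ : ℕ∞) : Prop :=
  IsGreatest {s | ∃ G : ℕ → Digraph V, (∀ i, G i ∈ 𝒢) ∧ broadcastTime G = s} τ

end DynamicBroadcast

/-!
**Upper bound.** Suppose that there is no broadcaster after `t` rounds, and let `r i` be the root of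
round `i`. The nodes reached by `x` gain a node in every round whose root they contain, and they never
fill the whole graph, so at most `n - 2` rounds have a root reached by `x` (`card_reached_roots_lt`).
Hence, if `S i` is the set of nodes that reach `r i` before round `i`, the cardinalities of the `S i`
sum to at most `n (n - 2)`. Seen backwards from a round `i`, the nodes that can still reach `r i` gain
a node in every round whose root is not among them, and end up as `S i`; so all but at most
`|S i| - 1` of the earlier roots `r j` reach `r i` in time (`card_not_reaching_roots_lt`). The number of pairs
`j < i` for which `r j` reaches `r i` is therefore at least about `t ^ 2 / 2 - n ^ 2`. On the other
hand, row growth from round `j` on leaves at most `min (n - 2) (t - 1 - j)` such `i` for each `j`,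
about `n t - n ^ 2 / 2` pairs in all. Comparing the two gives
`(t + 1) ^ 2 < 2 n (t + 1) + n ^ 2` (`sq_lt_of_not_hasBroadcaster`), which is `t + 1 < (1 + √2) n`.

**Lower bound.** Place the nodes on a cycle `0, 1, …, n - 1` (`slowTrees`). For `n - 2` rounds the
root is `0`, which reaches one new node a round: the top of a path through the nodes it has not
reached yet, which form an interval. The path is traversed alternately in the two directions, and its
top is removed from alternating ends of the interval, so every other node reaches an arc of the cycle
growing by at most one node a round and of final length at most `⌈n / 2⌉` (`slowTrees_early`). Then
the only node not reached by `0` becomes the root for good, so `0` never completes. The tree is now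
the cycle cut at the new root, along which each arc grows by at most one node a round, so another
`⌊n / 2⌋ - 1` rounds complete none of them (`slowTrees_late`).
-/

namespace DynamicBroadcast

/-! ### Products of reflexive digraphs -/

section Products

variable {V : Type*}

theorem productUpTo_refl {G : ℕ → Digraph V} (hG : ∀ i x, (G i).Adj x x) (t : ℕ) (x : V) :
    (productUpTo G t).Adj x x := by
  induction t with
  | zero => exact rfl
  | succ t ih => exact ⟨x, ih, hG t x⟩

theorem productUpTo_add (G : ℕ → Digraph V) (a b : ℕ) (x y : V) :
    (productUpTo G (a + b)).Adj x y ↔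
      ∃ z, (productUpTo G a).Adj x z ∧ (productUpTo (fun m => G (a + m)) b).Adj z y := by
  induction b generalizing y with
  | zero => exact ⟨fun h => ⟨y, h, rfl⟩, by rintro ⟨z, h, rfl⟩; exact h⟩
  | succ b ih =>
    constructor
    · rintro ⟨w, hw, hwy⟩
      obtain ⟨z, hz, hzw⟩ := (ih w).1 hw
      exact ⟨z, hz, w, hzw, hwy⟩
    · rintro ⟨z, hz, w, hzw, hwy⟩
      exact ⟨w, (ih w).2 ⟨z, hz, hzw⟩, hwy⟩

theorem productUpTo_mono {G : ℕ → Digraph V} (hG : ∀ i x, (G i).Adj x x) {s t : ℕ} (hst : s ≤ t)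
    {x y : V} (h : (productUpTo G s).Adj x y) : (productUpTo G t).Adj x y := by
  obtain ⟨k, rfl⟩ := Nat.exists_eq_add_of_le hst
  exact (productUpTo_add G s k x y).2 ⟨y, h, productUpTo_refl (fun i => hG (s + i)) k y⟩

end Products

/-! ### Growth of reached and reaching sets, and the pair count -/

section Growth

variable {V : Type*}

/-- A reflexive digraph in which some edge leaves every proper set of nodes that contains `r`. For a
rooted tree with self-loops this is all that the upper bound uses: it makes a set containing the
root grow under out-neighbours, and (by taking complements) a nonempty set avoiding the root grow
under in-neighbours. -/
structure SpreadsFrom (A : Digraph V) (r : V) : Prop where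
  refl : ∀ x, A.Adj x x
  exists_edge : ∀ X : Set V, r ∈ X → X ≠ Set.univ → ∃ x ∈ X, ∃ y ∉ X, A.Adj x y

theorem IsRootedTreeAt.spreadsFrom {T : Digraph V} {r : V} (h : IsRootedTreeAt T r) :
    SpreadsFrom (addLoops T) r where
  refl x := Or.inl rfl
  exists_edge X hr hX := by
    by_contra! hc
    refine hX (Set.eq_univ_of_forall fun y => ?_)
    induction h.reachable y with
    | refl => exact hr
    | tail _ hbc ih =>
      by_contra hn
      exact hc _ ih _ hn (Or.inr hbc)

variable [Fintype V] {G : ℕ → Digraph V} {r : ℕ → V}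

open scoped Finset

open Classical in
/-- The set of nodes reached by `x` gains a node in each round whose root it contains. -/
theorem card_reached_roots_lt (h : ∀ i, SpreadsFrom (G i) (r i)) (t : ℕ) (x : V)
    (hx : ∃ y, ¬ (productUpTo G t).Adj x y) :
    #{i ∈ Finset.range t | (productUpTo G i).Adj x (r i)} + 1
      ≤ #{y | (productUpTo G t).Adj x y} := by
  have hrefl i z := (h i).refl z
  induction t with
  | zero => simpa using ⟨x, (Finset.mem_filter_univ x).2 (productUpTo_refl hrefl 0 x)⟩
  | succ t ih =>
    obtain ⟨y, hy⟩ := hx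
    have hy' : ¬ (productUpTo G t).Adj x y := fun h' => hy (productUpTo_mono hrefl t.le_succ h')
    have ih := ih ⟨y, hy'⟩
    have hsub : ({y | (productUpTo G t).Adj x y} : Finset V)
        ⊆ ({y | (productUpTo G (t + 1)).Adj x y} : Finset V) := by
      intro z hz
      simp only [Finset.mem_filter_univ] at hz ⊢
      exact productUpTo_mono hrefl t.le_succ hz
    rw [Finset.card_filter, Finset.sum_range_succ, ← Finset.card_filter]
    split_ifs with hr
    · obtain ⟨a, ha, b, hb, hab⟩ := (h t).exists_edge {z | (productUpTo G t).Adj x z} hr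
        fun hu => hy' (hu ▸ Set.mem_univ y : y ∈ {z | (productUpTo G t).Adj x z})
      have := Finset.card_lt_card (hsub.ssubset_of_mem_notMem (a := b)
        (by simpa using ⟨a, ha, hab⟩) (by simpa using hb))
      omega
    · have := Finset.card_le_card hsub
      omega

open Classical in
/-- Read backwards from round `k`, the set of nodes that still manage to reach `y` gains a node in
each round whose root it does not contain. -/
theorem card_not_reaching_roots_lt (h : ∀ i, SpreadsFrom (G i) (r i)) (k : ℕ) (y : V) :
    #{j ∈ Finset.range k | ¬ (productUpTo (fun m => G (j + m)) (k - j)).Adj (r j) y} + 1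
      ≤ #{x | (productUpTo G k).Adj x y} := by
  induction k generalizing G r with
  | zero => simpa using ⟨y, (Finset.mem_filter_univ y).2 (productUpTo_refl (fun i => (h i).refl) 0 y)⟩
  | succ k ih =>
    have ih := ih (G := fun m => G (1 + m)) (r := fun m => r (1 + m)) fun i => h (1 + i)
    have hrefl i z := (h (1 + i)).refl z
    have hfront x : (productUpTo G (k + 1)).Adj x y ↔
        ∃ z, (G 0).Adj x z ∧ (productUpTo (fun m => G (1 + m)) k).Adj z y := by
      rw [add_comm k 1, productUpTo_add]
      refine exists_congr fun z => and_congr_left fun _ => ?_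
      exact ⟨by rintro ⟨_, rfl, hz⟩; exact hz, fun hz => ⟨x, rfl, hz⟩⟩
    have hshift j : (fun m => G (1 + (j + m))) = fun m => G (j + 1 + m) := by
      funext m
      congr 1
      omega
    have hsub : ({x | (productUpTo (fun m => G (1 + m)) k).Adj x y} : Finset V)
        ⊆ ({x | (productUpTo G (k + 1)).Adj x y} : Finset V) := by
      intro z hz
      simp only [Finset.mem_filter_univ] at hz ⊢
      exact (hfront z).2 ⟨z, (h 0).refl z, hz⟩
    simp only [hshift] at ih
    simp only [add_comm 1] at ih
    rw [Finset.card_filter, Finset.sum_range_succ']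
    simp only [Nat.add_sub_add_right, Nat.sub_zero, zero_add]
    rw [← Finset.card_filter]
    split_ifs with hr
    · have := Finset.card_le_card hsub
      simp only [add_comm 1] at this
      omega
    · have hr' : ¬ (productUpTo (fun m => G (1 + m)) k).Adj (r 0) y :=
        fun h' => hr ((hfront _).2 ⟨_, (h 0).refl _, h'⟩)
      obtain ⟨a, ha, b, hb, hab⟩ := (h 0).exists_edge
        {z | ¬ (productUpTo (fun m => G (1 + m)) k).Adj z y} hr' fun hu =>
          (hu ▸ Set.mem_univ y : y ∈ {z | ¬ (productUpTo (fun m => G (1 + m)) k).Adj z y})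
            (productUpTo_refl hrefl k y)
      have := Finset.card_lt_card (hsub.ssubset_of_mem_notMem (a := a)
        (by simpa using (hfront a).2 ⟨b, hab, by simpa using hb⟩) (by simpa using ha))
      simp only [add_comm 1] at this
      omega

theorem two_mul_sum_min_add_le (m d : ℕ) :
    2 * ∑ k ∈ Finset.range (m + d), min m k + m ^ 2 + m ≤ 2 * m * (m + d) := by
  induction d with
  | zero =>
    have : ∑ k ∈ Finset.range (m + 0), min m k = ∑ k ∈ Finset.range m, k :=
      Finset.sum_congr rfl fun k hk => min_eq_right (Finset.mem_range.1 hk).le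
    have hs := Finset.sum_range_id_mul_two m
    rw [this]
    cases m with
    | zero => simp
    | succ m => simp only [Nat.add_sub_cancel] at hs; nlinarith
  | succ d ih =>
    rw [← add_assoc, Finset.sum_range_succ, min_eq_left (Nat.le_add_right m d)]
    linarith

open Classical in
/-- Without a broadcaster after `t` rounds, count the pairs of rounds `j < i` such that the root of
round `j` reaches the root of round `i` in time. Row growth bounds the number of such `i` for each
`j`, column growth bounds the number of missing `j` for each `i`. -/
theorem sq_lt_of_not_hasBroadcaster (h : ∀ i, SpreadsFrom (G i) (r i)) (t : ℕ)
    (hb : ¬ HasBroadcaster (productUpTo G t)) :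
    (t + 1) ^ 2 < 2 * Fintype.card V * (t + 1) + Fintype.card V ^ 2 := by
  have hrefl i z := (h i).refl z
  have hb' : ∀ x, ∃ y, ¬ (productUpTo G t).Adj x y := by
    simpa only [HasBroadcaster, not_exists, not_forall] using hb
  have hrow x : #{i ∈ Finset.range t | (productUpTo G i).Adj x (r i)} + 2 ≤ Fintype.card V := by
    obtain ⟨y, hy⟩ := hb' x
    have h1 := card_reached_roots_lt h t x ⟨y, hy⟩
    have h2 : #{y | (productUpTo G t).Adj x y} < Fintype.card V :=
      Finset.card_lt_univ_of_notMem (x := y) (by simpa using hy)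
    omega
  obtain ⟨m, hm⟩ : ∃ m, Fintype.card V = m + 2 :=
    Nat.exists_eq_add_of_le' (le_trans (Nat.le_add_left 2 _) (hrow (r 0)))
  rw [hm] at hrow ⊢
  rcases le_total t m with htm | htm
  · nlinarith
  -- `E j i`: the root of round `j` reaches the root of round `i` through the rounds `j, …, i - 1`.
  let E (j i : ℕ) : Prop := (productUpTo (fun k => G (j + k)) (i - j)).Adj (r j) (r i)
  have hcols : ∑ i ∈ Finset.range t, #{x | (productUpTo G i).Adj x (r i)} ≤ (m + 2) * m := by
    calc ∑ i ∈ Finset.range t, #{x | (productUpTo G i).Adj x (r i)}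
        = ∑ x, #{i ∈ Finset.range t | (productUpTo G i).Adj x (r i)} := by
          simp only [Finset.card_filter]
          exact Finset.sum_comm
      _ ≤ ∑ _x : V, m := Finset.sum_le_sum fun x _ => by have := hrow x; omega
      _ = (m + 2) * m := by simp [hm]
  have hout j (hj : j ∈ Finset.range t) :
      #{i ∈ Finset.range t | j < i ∧ E j i} ≤ min m (t - 1 - j) := by
    have hj := Finset.mem_range.1 hj
    refine le_min ?_ ?_
    · obtain ⟨y, hy⟩ := hb' (r j)
      have hy' : ¬ (productUpTo (fun k => G (j + k)) (t - j)).Adj (r j) y := fun h' => hy <| by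
        have := (productUpTo_add G j (t - j) (r j) y).2 ⟨r j, productUpTo_refl hrefl j _, h'⟩
        rwa [Nat.add_sub_cancel' hj.le] at this
      have h1 := card_reached_roots_lt (fun i => h (j + i)) (t - j) (r j) ⟨y, hy'⟩
      have h2 : #{y | (productUpTo (fun k => G (j + k)) (t - j)).Adj (r j) y} < Fintype.card V :=
        Finset.card_lt_univ_of_notMem (x := y) (by simpa using hy')
      have h3 : #{i ∈ Finset.range t | j < i ∧ E j i} ≤ #{i ∈ Finset.range (t - j) |
          (productUpTo (fun k => G (j + k)) i).Adj (r j) (r (j + i))} := by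
        refine Finset.card_le_card_of_injOn (fun i => i - j) ?_ ?_
        · intro i hi
          simp only [Finset.coe_filter, Finset.mem_range, Set.mem_ofPred_eq] at hi ⊢
          refine ⟨by omega, ?_⟩
          rw [Nat.add_sub_cancel' hi.2.1.le]
          exact hi.2.2
        · intro a ha b hb hab
          simp only [Finset.coe_filter, Finset.mem_range, Set.mem_ofPred_eq] at ha hb hab
          omega
      omega
    · refine (Finset.card_le_card (t := Finset.Ioo j t) fun i hi => ?_).trans (by simp; omega)
      simp only [Finset.mem_filter, Finset.mem_range, Finset.mem_Ioo] at hi ⊢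
      omega
  have hin i (hi : i ∈ Finset.range t) :
      i + 1 ≤ #{j ∈ Finset.range t | j < i ∧ E j i} + #{x | (productUpTo G i).Adj x (r i)} := by
    have hi := Finset.mem_range.1 hi
    have h1 := card_not_reaching_roots_lt h i (r i)
    have h2 := Finset.card_filter_add_card_filter_not (s := Finset.range i) (fun j => E j i)
    have h3 : #{j ∈ Finset.range i | E j i} ≤ #{j ∈ Finset.range t | j < i ∧ E j i} := by
      refine Finset.card_le_card fun j hj => ?_
      simp only [Finset.mem_filter, Finset.mem_range] at hj ⊢
      exact ⟨by omega, hj⟩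
    rw [Finset.card_range] at h2
    change #{j ∈ Finset.range i | ¬ E j i} + 1 ≤ _ at h1
    omega
  have hpairs : ∑ i ∈ Finset.range t, #{j ∈ Finset.range t | j < i ∧ E j i}
      ≤ ∑ k ∈ Finset.range t, min m k := by
    rw [← Finset.sum_range_reflect (fun k => min m k)]
    refine le_trans (le_of_eq ?_) (Finset.sum_le_sum hout)
    simp only [Finset.card_filter]
    exact Finset.sum_comm
  have htot := (Finset.sum_le_sum hin).trans_eq Finset.sum_add_distrib
  have hgauss : 2 * ∑ i ∈ Finset.range t, (i + 1) = t * (t + 1) := by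
    have := Finset.sum_range_id_mul_two (t + 1)
    rw [Finset.sum_range_succ'] at this
    simp only [Nat.add_sub_cancel] at this
    linarith
  obtain ⟨d, rfl⟩ := Nat.exists_eq_add_of_le htm
  have hmin := two_mul_sum_min_add_le m d
  nlinarith

end Growth

/-! ### Rooted trees from parent functions -/

section Trees

/-- The digraph on `Fin n` in which every node `y` other than `r` has the single parent `par y`. -/
def parentDigraph (n r : ℕ) (par : ℕ → ℕ) : Digraph (Fin n) where
  Adj x y := (y : ℕ) ≠ r ∧ (x : ℕ) = par y

/-- If some rank decreases from each node to its parent, a parent function defines a rooted tree. -/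
theorem isRootedTreeAt_parentDigraph {n r : ℕ} (hr : r < n) {par : ℕ → ℕ} (rank : ℕ → ℕ)
    (hpar : ∀ y < n, y ≠ r → par y < n ∧ rank (par y) < rank y) :
    IsRootedTreeAt (parentDigraph n r par) ⟨r, hr⟩ where
  no_parent_root _ h := h.1 rfl
  unique_parent y hy := by
    have hy' : (y : ℕ) ≠ r := fun h => hy (Fin.ext h)
    exact ⟨⟨par y, (hpar y y.2 hy').1⟩, ⟨hy', rfl⟩, fun x hx => Fin.ext hx.2⟩
  reachable y := by
    induction hk : rank y using Nat.strong_induction_on generalizing y with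
    | _ k ih =>
      by_cases hy : (y : ℕ) = r
      · obtain rfl : y = ⟨r, hr⟩ := Fin.ext hy
        exact .refl
      · obtain ⟨h1, h2⟩ := hpar y y.2 hy
        exact (ih _ (hk ▸ h2) ⟨par y, h1⟩ rfl).tail ⟨hy, rfl⟩

end Trees

/-! ### A slow sequence of trees -/

section Adversary

/-- Root of round `t + 1` in the slow sequence of trees on `Fin n`. -/
def slowRoot (n t : ℕ) : ℕ :=
  if t < n - 2 then 0 else (n - 1) / 2 + 1

/-- Parents in round `t + 1` of the slow sequence of trees. In the first `n - 2` rounds the nodes of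
the interval `[(t + 1) / 2 + 1, n - 1 - t / 2]` form a path below the root `0`, in increasing order
for even `t` and in decreasing order for odd `t`, and all other nodes are children of `0`; each round
removes the top of the path from the interval. In the later rounds the tree is the cycle
`0, 1, …, n - 1` without the edge into the last node of the interval. -/
def slowParent (n t y : ℕ) : ℕ :=
  if t < n - 2 then
    if t % 2 = 0 then
      if t / 2 + 1 < y ∧ y + t / 2 < n then y - 1 else 0
    else
      if t / 2 + 2 ≤ y ∧ y + t / 2 + 1 < n then y + 1 else 0
  else if y = 0 then n - 1 else y - 1

/-- The slow sequence of trees, with self-loops. -/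
def slowTrees (n t : ℕ) : Digraph (Fin n) :=
  addLoops (parentDigraph n (slowRoot n t) (slowParent n t))

theorem slowTrees_mem_rootedTrees {n : ℕ} (hn : 2 ≤ n) (t : ℕ) : slowTrees n t ∈ rootedTrees n := by
  have hr : slowRoot n t < n := by
    unfold slowRoot
    split_ifs <;> omega
  refine ⟨_, ⟨⟨_, hr⟩, isRootedTreeAt_parentDigraph hr (fun y =>
    if t < n - 2 then (if t % 2 = 0 then y else if y = 0 then 0 else n - y)
    else if slowRoot n t ≤ y then y - slowRoot n t else y + n - slowRoot n t) ?_⟩, rfl⟩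
  intro y hy hyr
  unfold slowRoot slowParent at *
  split_ifs at * <;> omega

/-- In the first `n - 2` rounds of the slow sequence, node `0` misses the current interval, and the
nodes reached by any other node `x` lie in an interval that grows alternately at its two ends. A node
`y` newly reached on the right in round `t + 1`, with `t = 2 k`, satisfies both `y ≤ x + k + 1` and
`y ≤ n - 1 - k`, as it lies in the current interval, so `2 y ≤ n + x`; symmetrically, `x + 1 ≤ 2 y`
on the left. -/
theorem slowTrees_early {n : ℕ} (t : ℕ) (ht : t ≤ n - 2) (x y : Fin n)
    (h : (productUpTo (slowTrees n) t).Adj x y) :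
    ((x : ℕ) = 0 → (y : ℕ) ≤ (t + 1) / 2 ∨ n ≤ y + t / 2) ∧
    ((x : ℕ) ≠ 0 → (y : ℕ) ≤ x + (t + 1) / 2 ∧ 2 * (y : ℕ) ≤ n + x ∧
      (x : ℕ) ≤ y + t / 2 ∧ (x : ℕ) + 1 ≤ 2 * y) := by
  induction t generalizing y with
  | zero =>
    obtain rfl : x = y := h
    omega
  | succ t ih =>
    obtain ⟨z, hz, hzy⟩ := h
    have ih := ih (by omega) z hz
    have hy := y.2
    rcases hzy with rfl | ⟨hy0, hpar⟩
    · omega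
    · unfold slowRoot at hy0
      unfold slowParent at hpar
      split_ifs at hy0 hpar <;> omega

/-- In the later rounds of the slow sequence, node `0` keeps missing the root, and the nodes reached
by any other node lie in an arc of the cycle that grows by at most one node a round. -/
theorem slowTrees_late {n : ℕ} (u : ℕ) (x y : Fin n)
    (h : (productUpTo (slowTrees n) (n - 2 + u)).Adj x y) :
    ((x : ℕ) = 0 → (y : ℕ) ≠ (n - 1) / 2 + 1) ∧
    ((x : ℕ) ≠ 0 → ((x : ℕ) + 1 ≤ 2 * y ∧ 2 * (y : ℕ) ≤ n + x + 2 * u) ∨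
      2 * ((y : ℕ) + n) ≤ n + x + 2 * u) := by
  induction u generalizing y with
  | zero =>
    have := slowTrees_early (n - 2) le_rfl x y h
    have hy := y.2
    omega
  | succ u ih =>
    obtain ⟨z, hz, hzy⟩ := h
    have ih := ih z hz
    have hy := y.2
    rcases hzy with rfl | ⟨hy0, hpar⟩
    · omega
    · have hlate : ¬ n - 2 + u < n - 2 := by omega
      simp only [slowRoot, slowParent, Nat.add_eq, hlate, if_false] at hy0 hpar
      split_ifs at hpar <;> omega

theorem not_hasBroadcaster_slowTrees {n : ℕ} (hn : 2 ≤ n) :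
    ¬ HasBroadcaster (productUpTo (slowTrees n) (n - 2 + (n / 2 - 1))) := by
  rintro ⟨x, hx⟩
  have hxn := x.2
  by_cases hx0 : (x : ℕ) = 0
  · exact (slowTrees_late _ x ⟨(n - 1) / 2 + 1, by omega⟩ (hx _)).1 hx0 rfl
  · -- the node just before the arc of `x`
    have := (slowTrees_late _ x ⟨x / 2, by omega⟩ (hx _)).2 hx0
    dsimp only at this
    omega

end Adversary

/-! ### Broadcast times and their maximum -/

section BroadcastTime

variable {V : Type*} {G : ℕ → Digraph V}

theorem broadcastTime_le {t : ℕ} (ht : 1 ≤ t) (h : HasBroadcaster (productUpTo G t)) :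
    broadcastTime G ≤ t :=
  iInf_le (fun s : {s : ℕ // 1 ≤ s ∧ HasBroadcaster (productUpTo G s)} => ((s : ℕ) : ℕ∞)) ⟨t, ht, h⟩

theorem lt_broadcastTime (hG : ∀ i x, (G i).Adj x x) {t : ℕ}
    (h : ¬ HasBroadcaster (productUpTo G t)) : ((t + 1 : ℕ) : ℕ∞) ≤ broadcastTime G := by
  refine le_iInf fun ⟨s, _, x, hx⟩ => Nat.cast_le.2 (Nat.succ_le_of_lt ?_)
  by_contra! hst
  exact h ⟨x, fun y => productUpTo_mono hG hst (hx y)⟩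

/-- The maximum over all sequences is attained because the broadcast times are bounded by a natural
number. -/
theorem exists_isAdversaryBroadcastTime {𝒢 : Set (Digraph V)} {L U : ℕ}
    (hle : ∀ G : ℕ → Digraph V, (∀ i, G i ∈ 𝒢) → broadcastTime G ≤ U)
    (hge : ∃ G : ℕ → Digraph V, (∀ i, G i ∈ 𝒢) ∧ (L : ℕ∞) ≤ broadcastTime G) :
    ∃ τ : ℕ, IsAdversaryBroadcastTime 𝒢 (τ : ℕ∞) ∧ L ≤ τ ∧ τ ≤ U := by
  obtain ⟨G₀, hG₀, hL⟩ := hge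
  let A : Set ℕ := {k | ∃ G : ℕ → Digraph V, (∀ i, G i ∈ 𝒢) ∧ broadcastTime G = k}
  have hlift : ∀ G : ℕ → Digraph V, (∀ i, G i ∈ 𝒢) → ∃ k ∈ A, broadcastTime G = (k : ℕ∞) := by
    intro G hG
    obtain ⟨k, hk⟩ := ENat.ne_top_iff_exists.1 (ne_top_of_le_ne_top (ENat.natCast_ne_top U) (hle G hG))
    exact ⟨k, ⟨G, hG, hk.symm⟩, hk.symm⟩
  have hbdd : BddAbove A := ⟨U, by
    rintro k ⟨G, hG, hk⟩
    exact Nat.cast_le.1 (hk ▸ hle G hG)⟩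
  obtain ⟨k₀, hk₀, hG₀k⟩ := hlift G₀ hG₀
  obtain ⟨G, hG, hτ⟩ := Nat.sSup_mem ⟨k₀, hk₀⟩ hbdd
  refine ⟨sSup A, ⟨⟨G, hG, hτ⟩, ?_⟩, ?_, ?_⟩
  · rintro _ ⟨H, hH, rfl⟩
    obtain ⟨k, hk, hHk⟩ := hlift H hH
    rw [hHk]
    exact Nat.cast_le.2 (le_csSup hbdd hk)
  · exact (Nat.cast_le.1 (hG₀k ▸ hL)).trans (le_csSup hbdd hk₀)
  · exact Nat.cast_le.1 (hτ ▸ hle G hG)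

end BroadcastTime

/-! ### The two bounds for rooted trees -/

section Bounds

/-- The linear upper bound: `(t + 1) ^ 2 < 2 n (t + 1) + n ^ 2` means `t + 1 < (1 + √2) n`. -/
theorem hasBroadcaster_of_mem_rootedTrees {n t : ℕ} {G : ℕ → Digraph (Fin n)}
    (hG : ∀ i, G i ∈ rootedTrees n) (ht : (1 + Real.sqrt 2) * (n : ℝ) - 1 ≤ t) :
    HasBroadcaster (productUpTo G t) := by
  have hspread : ∀ i, ∃ r, SpreadsFrom (G i) r := fun i => by
    obtain ⟨T, ⟨r, hT⟩, hGT⟩ := hG i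
    exact ⟨r, hGT ▸ hT.spreadsFrom⟩
  choose r hr using hspread
  by_contra hb
  have hlt := sq_lt_of_not_hasBroadcaster hr t hb
  rw [Fintype.card_fin] at hlt
  have hlt : ((t : ℝ) + 1) ^ 2 < 2 * n * (t + 1) + n ^ 2 := by exact_mod_cast hlt
  have h2 : Real.sqrt 2 ^ 2 = 2 := Real.sq_sqrt (by norm_num)
  have hle : Real.sqrt 2 * n ≤ t + 1 - n := by linarith
  have hsq := pow_le_pow_left₀ (by positivity) hle 2
  rw [mul_pow, h2] at hsq
  linarith

theorem exists_rootedTrees_broadcastTime_ge {n : ℕ} (hn : 1 ≤ n) :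
    ∃ G : ℕ → Digraph (Fin n), (∀ i, G i ∈ rootedTrees n) ∧
      ((n + n / 2 - 2 : ℕ) : ℕ∞) ≤ broadcastTime G := by
  obtain rfl | hn : n = 1 ∨ 2 ≤ n := by omega
  · have htree : IsRootedTreeAt (parentDigraph 1 0 id) ⟨0, one_pos⟩ :=
      isRootedTreeAt_parentDigraph one_pos id (by omega)
    exact ⟨fun _ => addLoops _, fun _ => ⟨_, ⟨_, htree⟩, rfl⟩, by simp⟩
  · refine ⟨slowTrees n, slowTrees_mem_rootedTrees hn, le_trans (Nat.cast_le.2 ?_)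
      (lt_broadcastTime (fun i x => (Or.inl rfl : (slowTrees n i).Adj x x)) (not_hasBroadcaster_slowTrees hn))⟩
    omega

end Bounds

end DynamicBroadcast

theorem theorem1 (n : ℕ) (hn : 1 ≤ n) :
    ∃ τ : ℕ, DynamicBroadcast.IsAdversaryBroadcastTime (DynamicBroadcast.rootedTrees n) (τ : ℕ∞) ∧
      ⌈(3 * (n : ℝ) - 1) / 2⌉ - 2 ≤ (τ : ℤ) ∧
      (τ : ℤ) ≤ ⌈(1 + Real.sqrt 2) * (n : ℝ) - 1⌉ := by
  have hn' : (1 : ℝ) ≤ n := by exact_mod_cast hn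
  have hpos : 0 < (1 + Real.sqrt 2) * (n : ℝ) - 1 := by
    have : 0 < Real.sqrt 2 * (n : ℝ) := by positivity
    linarith
  have hU : 1 ≤ ⌈(1 + Real.sqrt 2) * (n : ℝ) - 1⌉₊ := Nat.ceil_pos.2 hpos
  obtain ⟨τ, hτ, hL, hτU⟩ := DynamicBroadcast.exists_isAdversaryBroadcastTime
    (fun G hG => DynamicBroadcast.broadcastTime_le hU
      (DynamicBroadcast.hasBroadcaster_of_mem_rootedTrees hG (Nat.le_ceil _)))
    (DynamicBroadcast.exists_rootedTrees_broadcastTime_ge hn)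
  refine ⟨τ, hτ, ?_, ?_⟩
  · have h3 : 3 * (n : ℤ) - 1 ≤ 2 * (τ + 2) := by omega
    have h3 : 3 * (n : ℝ) - 1 ≤ 2 * (τ + 2) := by exact_mod_cast h3
    rw [sub_le_iff_le_add, Int.ceil_le]
    push_cast
    linarith
  · rw [← Int.natCast_ceil_eq_ceil hpos.le]
    exact_mod_cast hτU
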